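/- Let $\Lambda=\mathbb Z+i\mathbb Z$, $\Lambda_+=\{z\in\Lambda:\Re z\ge 0\}$ and $\alpha_\pm=\frac{1\pm i}{2}$. A function $f:\Lambda\to\mathbb C$ is discrete analytic if $$\frac{f(z+1+i)-f(z)}{1+i}=\frac{f(z+1)-f(z+i)}{1-i},\qquad z\in\Lambda .$$ The discrete integral of $f$ over a path $(z_0,\dots,z_n)$ in $\Lambda$ ($|z_k-z_{k-1}|=1$) is $\sum_{k=1}^n\frac{f(z_{k-1})+f(z_k)}2(z_k-z_{k-1})$; for discrete analytic $f$ it depends only on the end points. Put $(Zf)(z)=\frac{f(0)-f(z)}2+\int_0^z f\,\delta z$ and $z^{(n)}=(Z^n1)(z)$, $n=0,1,2,\dots$. A discrete analytic polynomial is a discrete analytic function on $\Lambda$ that is given by a complex polynomial in $z$ and its conjugate $z^*$. The functions $z^{(n)}$ form a basis of the space of discrete analytic polynomials, which is a commutative ring under pointwise addition and the convolution product $$\Big(\sum_m a_mz^{(m)}\Big)\odot\Big(\sum_n b_nz^{(n)}\Big)=\sum_{m,n}a_mb_nz^{(m+n)} .$$ Let $\mathbf H_2(\Lambda_+)$ be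 the space of functions on $\Lambda_+$ of the form $\sum_{n\ge0}\hat f(n)z^{(n)}$ with $\sum_n|\hat f(n)|^2<\infty$. For $\lambda\in\Lambda_+$ let $$R_\lambda=\{z\in\Lambda_+:\Re z\le\Re\lambda,\ |\Im z|\le|\Im\lambda|,\ \Im z\,\Im\lambda\ge0\},$$ and let $\alpha_\mp$ stand for $\alpha_-$ if $\Im\lambda\ge0$ and for $\alpha_+$ if $\Im\lambda<0$. **Claim.** Let $\lambda\in\Lambda_+$. A discrete analytic polynomial $p$ vanishes on $R_\lambda$ if and only if $$p(z)=z^{(\Re\lambda+1)}\odot(z+\alpha_\mp)^{\odot|\Im\lambda|}\odot q(z)$$ for some discrete analytic polynomial $q$. Consequently, in the ring of discrete analytic polynomials equipped with $\odot$, the discrete analytic polynomials whose restriction to $\Lambda_+$ belongs to $\mathbf H_2(\Lambda_+)$ and vanishes on $R_\lambda$ form a principal ideal, generated by $z^{(\Re\lambda+1)}\odot(z+\alpha_\mp)^{\odot|\Im\lambda|}$. -/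

import Mathlib

open Complex

noncomputable section

namespace DiscreteAnalytic

/-- The lattice point `i`. -/
def iL : GaussianInt := ⟨0, 1⟩

/-- The constants `α₊ = (1 + i) / 2` and `α₋ = (1 - i) / 2`. -/
def alphaPlus : ℂ := (1 + I) / 2

def alphaMinus : ℂ := (1 - I) / 2

/-- Discrete analytic functions on the lattice `Λ = ℤ + iℤ` (J. Ferrand). -/
def IsDA (f : GaussianInt → ℂ) : Prop :=
  ∀ z : GaussianInt, (f (z + 1 + iL) - f z) / (1 + I) = (f (z + 1) - f (z + iL)) / (1 - I)

/-- `γ 0, …, γ n` is a path in `Λ` from `a` to `b`: consecutive points are at distance one. -/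
def IsPath (γ : ℕ → GaussianInt) (n : ℕ) (a b : GaussianInt) : Prop :=
  γ 0 = a ∧ γ n = b ∧ ∀ k < n, ‖(γ (k + 1) : ℂ) - (γ k : ℂ)‖ = 1

/-- The discrete integral of `f` over the path `γ 0, …, γ n`. -/
def pathIntegral (f : GaussianInt → ℂ) (γ : ℕ → GaussianInt) (n : ℕ) : ℂ :=
  ∑ k ∈ Finset.range n, (f (γ k) + f (γ (k + 1))) / 2 * ((γ (k + 1) : ℂ) - (γ k : ℂ))

/-- The path from `0` to `z` that first runs along the real axis and then vertically;
the subtraction of natural numbers is truncated on purpose. -/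
def cornerPath (z : GaussianInt) (k : ℕ) : GaussianInt :=
  ⟨z.re.sign * (min k z.re.natAbs : ℕ), z.im.sign * (k - z.re.natAbs : ℕ)⟩

/-- The discrete integral from `0` to `z`, taken along `cornerPath z`. For a discrete analytic
function every other path gives the same value, see `pathIntegral_eq_integral`. -/
def integral (f : GaussianInt → ℂ) (z : GaussianInt) : ℂ :=
  pathIntegral f (cornerPath z) (z.re.natAbs + z.im.natAbs)

/-- The operator `Z`. -/
def Zop (f : GaussianInt → ℂ) (z : GaussianInt) : ℂ := (f 0 - f z) / 2 + integral f z

/-- The function `z ↦ z^{(n)}`, that is `Zⁿ 1`. -/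
def zpow (n : ℕ) : GaussianInt → ℂ := Zop^[n] (fun _ => 1)

/-- `f` is (the restriction to `Λ` of) a complex polynomial in `z` and `z*`. -/
def IsPoly (f : GaussianInt → ℂ) : Prop :=
  ∃ P : MvPolynomial (Fin 2) ℂ,
    ∀ z : GaussianInt, f z = MvPolynomial.eval ![(z : ℂ), (starRingEnd ℂ) (z : ℂ)] P

/-- The linear space of discrete analytic polynomials. -/
def DAPoly : Submodule ℂ (GaussianInt → ℂ) where
  carrier := {f | IsDA f ∧ IsPoly f}
  add_mem' := by
    rintro f g ⟨hf, P, hP⟩ ⟨hg, Q, hQ⟩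
    refine ⟨fun z => ?_, P + Q, fun z => by simp [hP, hQ]⟩
    have h1 := hf z
    have h2 := hg z
    simp only [Pi.add_apply]
    linear_combination h1 + h2
  zero_mem' := ⟨fun z => by simp, 0, fun z => by simp⟩
  smul_mem' := by
    rintro c f ⟨hf, P, hP⟩
    refine ⟨fun z => ?_, MvPolynomial.C c * P, fun z => by simp [hP]⟩
    have h1 := hf z
    simp only [Pi.smul_apply, smul_eq_mul]
    linear_combination c * h1

/-! ### Path independence -/

theorem mk_add_one (x y : ℤ) : (⟨x, y⟩ : GaussianInt) + 1 = ⟨x + 1, y⟩ := by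
  ext <;> simp

theorem mk_add_iL (x y : ℤ) : (⟨x, y⟩ : GaussianInt) + iL = ⟨x, y + 1⟩ := by
  ext <;> simp [iL]

theorem one_add_I_ne : (1 + I : ℂ) ≠ 0 := by
  intro h
  have := congrArg Complex.re h
  simp at this

theorem one_sub_I_ne : (1 - I : ℂ) ≠ 0 := by
  intro h
  have := congrArg Complex.re h
  simp at this

theorem isDA_iff (f : GaussianInt → ℂ) :
    IsDA f ↔ ∀ x y : ℤ, f ⟨x + 1, y + 1⟩ - f ⟨x, y⟩ = I * (f ⟨x + 1, y⟩ - f ⟨x, y + 1⟩) := by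
  have key : ∀ a b : ℂ, a / (1 + I) = b / (1 - I) ↔ a = I * b := by
    intro a b
    rw [div_eq_div_iff one_add_I_ne one_sub_I_ne]
    have e : b * (1 + I) = I * b * (1 - I) := by linear_combination (b : ℂ) * I_mul_I
    rw [e]
    exact mul_left_inj' one_sub_I_ne
  constructor
  · intro h x y
    have := (key _ _).1 (h ⟨x, y⟩)
    simpa only [mk_add_one, mk_add_iL] using this
  · rintro h ⟨x, y⟩
    rw [key]
    simpa only [mk_add_one, mk_add_iL] using h x y

/-- The discrete integral from `0` to `x` of a function on `ℤ`. -/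
def intAux (φ : ℤ → ℂ) (x : ℤ) : ℂ :=
  ∑ k ∈ Finset.range x.natAbs,
    (φ (x.sign * (k : ℕ)) + φ (x.sign * ((k + 1 : ℕ) : ℤ))) / 2 * (x.sign : ℂ)

theorem intAux_succ (φ : ℤ → ℂ) (x : ℤ) :
    intAux φ (x + 1) = intAux φ x + (φ x + φ (x + 1)) / 2 := by
  have hpos : ∀ n : ℕ, intAux φ (n : ℤ) =
      ∑ k ∈ Finset.range n, (φ (k : ℕ) + φ ((k + 1 : ℕ) : ℤ)) / 2 := by
    intro n
    rcases n with _ | n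
    · simp [intAux]
    · have hs : ((n + 1 : ℕ) : ℤ).sign = 1 := Int.sign_eq_one_of_pos (by positivity)
      simp only [intAux, hs, Int.natAbs_natCast, one_mul, Int.cast_one, mul_one]
  have hneg : ∀ n : ℕ, intAux φ (-(n : ℤ)) =
      ∑ k ∈ Finset.range n, -((φ (-(k : ℕ)) + φ (-((k + 1 : ℕ) : ℤ))) / 2) := by
    intro n
    rcases n with _ | n
    · simp [intAux]
    · have hs : (-((n + 1 : ℕ) : ℤ)).sign = -1 := Int.sign_eq_neg_one_of_neg (by omega)
      simp only [intAux, hs, Int.natAbs_neg, Int.natAbs_natCast, neg_mul, one_mul, Int.cast_neg,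
        Int.cast_one, mul_neg, mul_one]
  obtain ⟨n, rfl | rfl⟩ := x.eq_nat_or_neg
  · rw [← Nat.cast_succ, hpos, hpos, Finset.sum_range_succ]
  · rcases n with _ | n
    · simp [intAux]
    · have e : -((n + 1 : ℕ) : ℤ) + 1 = -(n : ℤ) := by push_cast; ring
      rw [e, hneg, hneg, Finset.sum_range_succ]
      ring

theorem integral_eq (f : GaussianInt → ℂ) (x y : ℤ) :
    integral f ⟨x, y⟩ = intAux (fun s => f ⟨s, 0⟩) x + I * intAux (fun s => f ⟨x, s⟩) y := by
  unfold integral pathIntegral intAux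
  simp only
  rw [Finset.sum_range_add, Finset.mul_sum]
  congr 1
  · refine Finset.sum_congr rfl fun k hk => ?_
    have hk' : k < x.natAbs := Finset.mem_range.1 hk
    have e1 : cornerPath ⟨x, y⟩ k = ⟨x.sign * (k : ℕ), 0⟩ := by
      ext <;> simp [cornerPath, hk'.le]
    have e2 : cornerPath ⟨x, y⟩ (k + 1) = ⟨x.sign * ((k + 1 : ℕ) : ℤ), 0⟩ := by
      have h1 : min (k + 1) x.natAbs = k + 1 := min_eq_left hk'
      have h2 : k + 1 - x.natAbs = 0 := by omega
      ext
      · simp only [cornerPath, h1]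
      · simp only [cornerPath, h2, Nat.cast_zero, mul_zero]
    rw [e1, e2, GaussianInt.toComplex_def', GaussianInt.toComplex_def']
    push_cast
    ring
  · refine Finset.sum_congr rfl fun k _ => ?_
    have e : ∀ k : ℕ, cornerPath ⟨x, y⟩ (x.natAbs + k) = ⟨x, y.sign * (k : ℕ)⟩ := by
      intro k
      have h1 : min (x.natAbs + k) x.natAbs = x.natAbs := min_eq_right (by omega)
      have h2 : x.natAbs + k - x.natAbs = k := by omega
      ext
      · simp only [cornerPath, h1, Int.sign_mul_natAbs]
      · simp only [cornerPath, h2]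
    rw [add_assoc, e, e, GaussianInt.toComplex_def', GaussianInt.toComplex_def']
    push_cast
    ring

theorem eq_of_step {D : ℤ → ℂ} (h : ∀ y, D (y + 1) = D y) (y : ℤ) : D y = D 0 := by
  induction y with
  | zero => rfl
  | succ n ih => rw [h, ih]
  | pred n ih =>
    rw [← ih, ← h (-(n : ℤ) - 1)]
    congr 1
    ring

theorem integral_zero (f : GaussianInt → ℂ) : integral f 0 = 0 := by
  simp [integral, pathIntegral]

theorem integral_step_im (f : GaussianInt → ℂ) (x y : ℤ) :
    integral f ⟨x, y + 1⟩ = integral f ⟨x, y⟩ + I * ((f ⟨x, y⟩ + f ⟨x, y + 1⟩) / 2) := by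
  rw [integral_eq, integral_eq, intAux_succ]
  ring

theorem integral_step_re {f : GaussianInt → ℂ} (hf : IsDA f) (x y : ℤ) :
    integral f ⟨x + 1, y⟩ = integral f ⟨x, y⟩ + (f ⟨x, y⟩ + f ⟨x + 1, y⟩) / 2 := by
  rw [isDA_iff] at hf
  have h := eq_of_step (D := fun y => integral f ⟨x + 1, y⟩ - integral f ⟨x, y⟩
    - (f ⟨x, y⟩ + f ⟨x + 1, y⟩) / 2) (fun y => by
      simp only [integral_step_im]
      have := hf x y
      linear_combination (-(1 - I) / 2 : ℂ) * this +
        ((f ⟨x + 1, y⟩ - f ⟨x, y + 1⟩) / 2) * I_mul_I) y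
  have h0 : integral f ⟨x + 1, 0⟩ = integral f ⟨x, 0⟩ + (f ⟨x, 0⟩ + f ⟨x + 1, 0⟩) / 2 := by
    simp only [integral_eq, intAux_succ]
    simp [intAux]
  simp only [h0] at h
  linear_combination h

/-- The discrete integral of a discrete analytic function does not depend on the path. -/
theorem pathIntegral_eq_integral {f : GaussianInt → ℂ} (hf : IsDA f) {γ : ℕ → GaussianInt}
    {n : ℕ} {z : GaussianInt} (h : IsPath γ n 0 z) : pathIntegral f γ n = integral f z := by
  obtain ⟨h0, hn, hs⟩ := h
  have edge : ∀ a b : GaussianInt, ‖(b : ℂ) - (a : ℂ)‖ = 1 →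
      (f a + f b) / 2 * ((b : ℂ) - (a : ℂ)) = integral f b - integral f a := by
    rintro ⟨x, y⟩ ⟨x', y'⟩ hab
    have h2 : (x' - x) ^ 2 + (y' - y) ^ 2 = 1 := by
      have h3 : Complex.normSq ((⟨x', y'⟩ : GaussianInt) - (⟨x, y⟩ : GaussianInt) : ℂ) = 1 := by
        rw [Complex.normSq_eq_norm_sq, hab]; norm_num
      rw [Complex.normSq_apply] at h3
      simp only [Complex.sub_re, Complex.sub_im, GaussianInt.re_toComplex,
        GaussianInt.im_toComplex] at h3
      have : (((x' - x) ^ 2 + (y' - y) ^ 2 : ℤ) : ℝ) = 1 := by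
        push_cast
        linarith
      exact_mod_cast this
    have bx : x' - x ≤ 1 ∧ -1 ≤ x' - x := by constructor <;> nlinarith [sq_nonneg (y' - y)]
    have hx : x' - x = 0 ∨ x' - x = 1 ∨ x' - x = -1 := by omega
    rw [GaussianInt.toComplex_def', GaussianInt.toComplex_def']
    rcases hx with hx | hx | hx
    · obtain rfl : x' = x := by omega
      have hy : (y' - y - 1) * (y' - y + 1) = 0 := by
        rw [hx] at h2
        linear_combination h2
      rcases mul_eq_zero.1 hy with hy | hy
      · obtain rfl : y' = y + 1 := by omega
        rw [integral_step_im]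
        push_cast
        ring
      · obtain rfl : y = y' + 1 := by omega
        rw [integral_step_im]
        push_cast
        ring
    · have hy : y' - y = 0 := by
        rw [hx] at h2
        exact pow_eq_zero_iff (n := 2) (by norm_num) |>.1 (by linarith)
      obtain rfl : y' = y := by omega
      obtain rfl : x' = x + 1 := by omega
      rw [integral_step_re hf]
      push_cast
      ring
    · have hy : y' - y = 0 := by
        rw [hx] at h2
        exact pow_eq_zero_iff (n := 2) (by norm_num) |>.1 (by linarith)
      obtain rfl : y' = y := by omega
      obtain rfl : x = x' + 1 := by omega
      rw [integral_step_re hf]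
      push_cast
      ring
  have : pathIntegral f γ n = ∑ k ∈ Finset.range n, (integral f (γ (k + 1)) - integral f (γ k)) :=
    Finset.sum_congr rfl fun k hk => edge _ _ (hs k (Finset.mem_range.1 hk))
  rw [this, Finset.sum_range_sub (fun k => integral f (γ k)), h0, hn, integral_zero, sub_zero]

theorem isPath_cornerPath (z : GaussianInt) :
    IsPath (cornerPath z) (z.re.natAbs + z.im.natAbs) 0 z := by
  refine ⟨?_, ?_, fun k hk => ?_⟩
  · ext <;> simp [cornerPath]
  · have h1 : min (z.re.natAbs + z.im.natAbs) z.re.natAbs = z.re.natAbs :=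
      min_eq_right (by omega)
    have h2 : z.re.natAbs + z.im.natAbs - z.re.natAbs = z.im.natAbs := by omega
    ext
    · simp only [cornerPath, h1, Int.sign_mul_natAbs]
    · simp only [cornerPath, h2, Int.sign_mul_natAbs]
  · have hsign : ∀ a : ℤ, a.natAbs ≠ 0 → ‖((a.sign : ℤ) : ℂ)‖ = 1 := by
      intro a ha
      rcases lt_trichotomy a 0 with h | h | h
      · simp [Int.sign_eq_neg_one_of_neg h]
      · simp [h] at ha
      · simp [Int.sign_eq_one_of_pos h]
    by_cases hk' : k < z.re.natAbs
    · have h1 : min (k + 1) z.re.natAbs = k + 1 := min_eq_left hk'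
      have h2 : k + 1 - z.re.natAbs = 0 := by omega
      have h3 : k - z.re.natAbs = 0 := by omega
      have h4 : min k z.re.natAbs = k := min_eq_left hk'.le
      have := hsign z.re (by omega)
      rw [← this]
      simp only [cornerPath, h1, h2, h3, h4, GaussianInt.toComplex_def']
      congr 1
      push_cast
      ring
    · have h1 : min (k + 1) z.re.natAbs = z.re.natAbs := min_eq_right (by omega)
      have h4 : min k z.re.natAbs = z.re.natAbs := min_eq_right (by omega)
      have h2 : k + 1 - z.re.natAbs = (k - z.re.natAbs) + 1 := by omega
      have := hsign z.im (by omega)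
      have e : ‖((z.im.sign : ℤ) : ℂ) * I‖ = 1 := by rw [norm_mul, this]; simp
      rw [← e]
      simp only [cornerPath, h1, h2, h4, GaussianInt.toComplex_def']
      congr 1
      push_cast
      ring

/-! ### The functions `z^{(n)}` form a basis of the discrete analytic polynomials -/

theorem isDA_one : IsDA (fun _ => 1) := fun z => by simp

theorem Zop_zero (f : GaussianInt → ℂ) : Zop f 0 = 0 := by simp [Zop, integral_zero]

theorem Zop_step_re {f : GaussianInt → ℂ} (hf : IsDA f) (x y : ℤ) :
    Zop f ⟨x + 1, y⟩ - Zop f ⟨x, y⟩ = f ⟨x, y⟩ := by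
  simp only [Zop, integral_step_re hf]
  ring

theorem isDA_Zop {f : GaussianInt → ℂ} (hf : IsDA f) : IsDA (Zop f) := by
  rw [isDA_iff]
  intro x y
  simp only [Zop, integral_step_im, integral_step_re hf]
  linear_combination ((f ⟨x, y⟩ + f ⟨x, y + 1⟩) / 2) * I_mul_I

theorem const_of_step_re {h : GaussianInt → ℂ} (hh : IsDA h)
    (hs : ∀ x y : ℤ, h ⟨x + 1, y⟩ = h ⟨x, y⟩) (z : GaussianInt) : h z = h 0 := by
  obtain ⟨x, y⟩ := z
  rw [isDA_iff] at hh
  have hy : ∀ y, h ⟨0, y + 1⟩ = h ⟨0, y⟩ := by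
    intro y
    have h1 := hh 0 y
    rw [hs, hs] at h1
    have h2 : (1 + I) * (h ⟨0, y + 1⟩ - h ⟨0, y⟩) = 0 := by linear_combination h1
    rcases mul_eq_zero.1 h2 with h3 | h3
    · exact absurd h3 one_add_I_ne
    · exact sub_eq_zero.1 h3
  rw [eq_of_step (D := fun x => h ⟨x, y⟩) (fun x => hs x y) x,
    eq_of_step (D := fun y => h ⟨0, y⟩) hy y]
  rfl

theorem isDA_zpow (n : ℕ) : IsDA (zpow n) := by
  induction n with
  | zero => exact isDA_one
  | succ n ih =>
    rw [zpow, Function.iterate_succ_apply']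
    exact isDA_Zop ih

theorem zpow_succ (n : ℕ) : zpow (n + 1) = Zop (zpow n) := by
  rw [zpow, Function.iterate_succ_apply']
  rfl

open PowerSeries in
/-- The generating function `(1 + t)^x ((1 + α₊ t) / (1 + α₋ t))^y` of the `z^{(n)}`. -/
def genSeries (x y : ℤ) : PowerSeries ℂ :=
  binomialSeries ℂ x * (rescale alphaPlus (binomialSeries ℂ y) *
    rescale alphaMinus (binomialSeries ℂ (-y)))

open PowerSeries in
theorem binomialSeries_one' : binomialSeries ℂ (1 : ℤ) = 1 + X := by
  simpa using binomialSeries_nat (R := ℤ) (A := ℂ) 1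

open PowerSeries in
theorem genSeries_step_re (x y : ℤ) : genSeries (x + 1) y = (1 + X) * genSeries x y := by
  simp only [genSeries, binomialSeries_add, binomialSeries_one']
  ring

open PowerSeries in
theorem genSeries_step_im (x y : ℤ) : (1 + C alphaMinus * X) * genSeries x (y + 1) =
    (1 + C alphaPlus * X) * genSeries x y := by
  have h : binomialSeries ℂ (-y) = binomialSeries ℂ (-(y + 1)) * (1 + X) := by
    rw [← binomialSeries_one', ← binomialSeries_add]
    congr 1
    ring
  simp only [genSeries, h, binomialSeries_add, binomialSeries_one', map_mul, map_add, map_one,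
    rescale_X]
  ring

open PowerSeries in
theorem genSeries_da (x y : ℤ) : genSeries (x + 1) (y + 1) - genSeries x y =
    C I * (genSeries (x + 1) y - genSeries x (y + 1)) := by
  have hne : (1 + C alphaMinus * X : PowerSeries ℂ) ≠ 0 := by
    intro h
    have := congrArg (constantCoeff (R := ℂ)) h
    simp at this
  apply mul_left_cancel₀ hne
  have h1 := genSeries_step_im x y
  have h2 : C alphaPlus = (C I * C alphaMinus : PowerSeries ℂ) := by
    rw [← map_mul]
    congr 1
    simp only [alphaPlus, alphaMinus]
    linear_combination (1 / 2 : ℂ) * I_mul_I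
  have h4 : (C alphaMinus : PowerSeries ℂ) * (1 + C I) = 1 := by
    rw [← map_one (C (R := ℂ)), ← map_add, ← map_mul]
    congr 1
    simp only [alphaMinus]
    linear_combination (-1 / 2 : ℂ) * I_mul_I
  rw [genSeries_step_re, genSeries_step_re]
  rw [h2] at h1
  linear_combination (1 + X + C I) * h1 + genSeries x y * X * (C I - 1) * h4

open PowerSeries in
theorem coeff_genSeries (n : ℕ) (x y : ℤ) : coeff n (genSeries x y) = zpow n ⟨x, y⟩ := by
  have hda : ∀ n, IsDA (fun z => coeff n (genSeries z.re z.im)) := by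
    intro n
    rw [isDA_iff]
    intro x y
    have := congrArg (coeff n) (genSeries_da x y)
    simpa using this
  suffices h : ∀ n, (fun z : GaussianInt => coeff n (genSeries z.re z.im)) = zpow n from
    congrFun (h n) ⟨x, y⟩
  intro n
  induction n with
  | zero =>
    funext z
    have hr : ∀ (a : ℂ) (φ : PowerSeries ℂ),
        constantCoeff (rescale a φ) = constantCoeff φ := by
      intro a φ
      rw [← coeff_zero_eq_constantCoeff_apply, coeff_rescale, pow_zero, one_mul,
        coeff_zero_eq_constantCoeff_apply]
    simp [genSeries, zpow, hr]
  | succ n ih =>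
    rw [zpow_succ]
    have hz := isDA_zpow n
    funext z
    rw [← sub_eq_zero]
    refine (const_of_step_re (h := fun z => coeff (n + 1) (genSeries z.re z.im) - Zop (zpow n) z)
      ?_ ?_ z).trans ?_
    · have h1 := (isDA_iff _).1 (hda (n + 1))
      have h2 := (isDA_iff _).1 (isDA_Zop hz)
      rw [isDA_iff]
      intro x y
      linear_combination h1 x y - h2 x y
    · intro x y
      have h1 := Zop_step_re hz x y
      have h2 := congrFun ih ⟨x, y⟩
      simp only at h2
      simp only [genSeries_step_re, add_mul, one_mul, map_add, coeff_succ_X_mul]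
      linear_combination h2 - h1
    · simp [Zop_zero, genSeries]

theorem IsPoly.add {f g : GaussianInt → ℂ} (hf : IsPoly f) (hg : IsPoly g) :
    IsPoly (fun z => f z + g z) := by
  obtain ⟨P, hP⟩ := hf
  obtain ⟨Q, hQ⟩ := hg
  exact ⟨P + Q, fun z => by simp [hP, hQ]⟩

theorem IsPoly.mul {f g : GaussianInt → ℂ} (hf : IsPoly f) (hg : IsPoly g) :
    IsPoly (fun z => f z * g z) := by
  obtain ⟨P, hP⟩ := hf
  obtain ⟨Q, hQ⟩ := hg
  exact ⟨P * Q, fun z => by simp [hP, hQ]⟩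

theorem IsPoly.const (c : ℂ) : IsPoly (fun _ => c) := ⟨MvPolynomial.C c, fun z => by simp⟩

theorem IsPoly.sum {ι : Type*} (s : Finset ι) {f : ι → GaussianInt → ℂ}
    (hf : ∀ i ∈ s, IsPoly (f i)) : IsPoly (fun z => ∑ i ∈ s, f i z) := by
  classical
  induction s using Finset.induction_on with
  | empty => simpa using IsPoly.const 0
  | insert a s ha ih =>
    simp only [Finset.sum_insert ha]
    exact (hf a (Finset.mem_insert_self a s)).add
      (ih fun i hi => hf i (Finset.mem_insert_of_mem hi))

theorem isPoly_self : IsPoly (fun z => (z : ℂ)) := ⟨MvPolynomial.X 0, fun z => by simp⟩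

theorem isPoly_re : IsPoly (fun z => (z.re : ℂ)) := by
  refine ⟨MvPolynomial.C (1 / 2) * (MvPolynomial.X 0 + MvPolynomial.X 1), fun z => ?_⟩
  simp [GaussianInt.toComplex_def]
  ring

theorem isPoly_im : IsPoly (fun z => (z.im : ℂ)) := by
  refine ⟨MvPolynomial.C (-I / 2) * (MvPolynomial.X 0 - MvPolynomial.X 1), fun z => ?_⟩
  simp [GaussianInt.toComplex_def]
  linear_combination ((z.im : ℂ)) * I_mul_I

theorem isPoly_choose {a : GaussianInt → ℤ} (ha : IsPoly (fun z => (a z : ℂ))) (n : ℕ) :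
    IsPoly (fun z => ((Ring.choose (a z) n : ℤ) : ℂ)) := by
  obtain ⟨P, hP⟩ := ha
  refine ⟨MvPolynomial.C (n.factorial : ℂ)⁻¹ * Polynomial.aeval P (descPochhammer ℤ n),
    fun z => ?_⟩
  have h := congrArg (fun k : ℤ => (k : ℂ)) (Ring.descPochhammer_eq_factorial_smul_choose (a z) n)
  simp only [nsmul_eq_mul, Int.cast_mul, Int.cast_natCast] at h
  have hn : (n.factorial : ℂ) ≠ 0 := by exact_mod_cast n.factorial_ne_zero
  rw [← Polynomial.aeval_eq_smeval] at h
  have h1 : (((Polynomial.aeval (a z)) (descPochhammer ℤ n) : ℤ) : ℂ) =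
      Polynomial.aeval ((a z : ℤ) : ℂ) (descPochhammer ℤ n) := by
    simpa using (Polynomial.aeval_algebraMap_apply ℂ (a z) (descPochhammer ℤ n)).symm
  have h2 : MvPolynomial.eval ![(z : ℂ), (starRingEnd ℂ) (z : ℂ)]
      (Polynomial.aeval P (descPochhammer ℤ n)) =
      Polynomial.aeval ((a z : ℤ) : ℂ) (descPochhammer ℤ n) := by
    have hPz : ((a z : ℤ) : ℂ) = _ := hP z
    rw [hPz]
    simp only [Polynomial.aeval_def, Polynomial.hom_eval₂]
    congr 1
    exact RingHom.ext_int _ _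
  rw [map_mul, MvPolynomial.eval_C, h2, ← h1, h, inv_mul_cancel_left₀ hn]

theorem isPoly_zpow (n : ℕ) : IsPoly (zpow n) := by
  have e : zpow n = fun z : GaussianInt => PowerSeries.coeff n (genSeries z.re z.im) := by
    funext z
    rw [coeff_genSeries]
  rw [e]
  simp only [genSeries, PowerSeries.coeff_mul, PowerSeries.coeff_rescale,
    PowerSeries.binomialSeries_coeff, zsmul_eq_mul, mul_one]
  have him : IsPoly (fun z => ((-z.im : ℤ) : ℂ)) := by
    simpa using (IsPoly.const (-1)).mul isPoly_im
  refine IsPoly.sum _ fun p _ => (isPoly_choose isPoly_re _).mul (IsPoly.sum _ fun q _ => ?_)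
  exact ((IsPoly.const _).mul (isPoly_choose isPoly_im _)).mul
    ((IsPoly.const _).mul (isPoly_choose him _))

/-- `z^{(n)}` as a discrete analytic polynomial. -/
def zpowDA (n : ℕ) : DAPoly := ⟨zpow n, isDA_zpow n, isPoly_zpow n⟩

theorem fwdDiff_zpow_zero : fwdDiff 1 (zpow 0) = 0 := by
  funext z
  simp [fwdDiff, zpow]

theorem fwdDiff_zpow_succ (n : ℕ) : fwdDiff 1 (zpow (n + 1)) = zpow n := by
  funext ⟨x, y⟩
  rw [zpow_succ, fwdDiff, mk_add_one, Zop_step_re (isDA_zpow n)]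

theorem zpow_apply_zero (n : ℕ) : zpow n 0 = if n = 0 then 1 else 0 := by
  rcases n with _ | n
  · simp [zpow]
  · simp [zpow_succ, Zop_zero]

theorem fwdDiff_iter_zero' (k : ℕ) : (fwdDiff (1 : GaussianInt))^[k] (0 : GaussianInt → ℂ) = 0 := by
  induction k with
  | zero => rfl
  | succ k ih =>
    rw [Function.iterate_succ_apply', ih]
    funext z
    simp [fwdDiff]

theorem fwdDiff_iter_zpow (k n : ℕ) :
    (fwdDiff 1)^[k] (zpow n) 0 = if n = k then 1 else 0 := by
  induction k generalizing n with
  | zero => simpa using zpow_apply_zero n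
  | succ k ih =>
    rw [Function.iterate_succ_apply]
    rcases n with _ | n
    · rw [fwdDiff_zpow_zero, fwdDiff_iter_zero']
      simp
    · rw [fwdDiff_zpow_succ, ih]
      simp

theorem linearIndependent_zpow : LinearIndependent ℂ zpow := by
  rw [linearIndependent_iff']
  intro s g hg k hk
  have h := congrFun (congrArg (fwdDiff (1 : GaussianInt))^[k] hg) 0
  rw [fwdDiff_iter_zero', fwdDiff_iter_finsetSum, Finset.sum_apply] at h
  simp only [fwdDiff_iter_const_smul, Pi.smul_apply, fwdDiff_iter_zpow, smul_eq_mul, mul_ite,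
    mul_one, mul_zero, Finset.sum_ite_eq', hk, if_true, Pi.zero_apply] at h
  exact h

theorem exists_fwdDiff_iter_eq_zero {f : GaussianInt → ℂ} (hf : IsPoly f) :
    ∃ N, (fwdDiff 1)^[N] f = 0 := by
  obtain ⟨P, hP⟩ := hf
  let Q : GaussianInt → Polynomial ℂ := fun z => MvPolynomial.aeval
    ![Polynomial.X + Polynomial.C (z : ℂ),
      Polynomial.X + Polynomial.C ((starRingEnd ℂ) (z : ℂ))] P
  have hdeg : ∀ z, (Q z).natDegree ≤ P.totalDegree := by
    intro z
    simp only [Q]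
    rw [MvPolynomial.aeval_def, MvPolynomial.eval₂_eq]
    refine Polynomial.natDegree_sum_le_of_forall_le _ _ fun d hd => ?_
    refine (Polynomial.natDegree_C_mul_le _ _).trans ?_
    refine (Polynomial.natDegree_prod_le _ _).trans ?_
    refine le_trans (Finset.sum_le_sum (g := fun i => d i) fun i _ => ?_)
      (MvPolynomial.le_totalDegree hd)
    refine Polynomial.natDegree_pow_le.trans ?_
    have : (![Polynomial.X + Polynomial.C (z : ℂ),
      Polynomial.X + Polynomial.C ((starRingEnd ℂ) (z : ℂ))] i).natDegree ≤ 1 := by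
      fin_cases i <;> simp
    simpa using Nat.mul_le_mul_left (d i) this
  have heval : ∀ (z : GaussianInt) (n : ℕ), (Q z).eval (n : ℂ) = f (z + n) := by
    intro z n
    rw [hP]
    simp only [Q]
    rw [MvPolynomial.aeval_def, ← Polynomial.coe_evalRingHom, MvPolynomial.hom_eval₂,
      ← MvPolynomial.eval₂_id]
    congr 1
    · ext c
      simp
    · funext i
      fin_cases i <;> simp [add_comm]
  refine ⟨P.totalDegree + 1, funext fun z => ?_⟩
  have h := congrFun (Polynomial.fwdDiff_iter_eq_zero_of_degree_lt
    (Nat.lt_succ_of_le (hdeg z))) 0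
  rw [fwdDiff_iter_eq_sum_shift] at h ⊢
  simpa [heval] using h

theorem mem_span_zpow {f : GaussianInt → ℂ} (hf : IsDA f) (hp : IsPoly f) :
    f ∈ Submodule.span ℂ (Set.range zpow) := by
  obtain ⟨N, hN⟩ := exists_fwdDiff_iter_eq_zero hp
  have hle : Submodule.span ℂ (Set.range zpow) ≤ DAPoly := by
    rw [Submodule.span_le]
    rintro _ ⟨n, rfl⟩
    exact (zpowDA n).2
  clear hp
  induction N generalizing f with
  | zero =>
    rw [show f = 0 from hN]
    exact Submodule.zero_mem _
  | succ N ih =>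
    have hda : IsDA (fwdDiff 1 f) := by
      rw [isDA_iff] at hf ⊢
      intro x y
      have h1 := hf x y
      have h2 := hf (x + 1) y
      simp only [fwdDiff, mk_add_one]
      linear_combination h2 - h1
    have hg := ih hda hN
    have lift : ∀ g ∈ Submodule.span ℂ (Set.range zpow),
        ∃ G ∈ Submodule.span ℂ (Set.range zpow), fwdDiff 1 G = g := by
      intro g hg
      induction hg using Submodule.span_induction with
      | mem g hg =>
        obtain ⟨n, rfl⟩ := hg
        exact ⟨zpow (n + 1), Submodule.subset_span ⟨n + 1, rfl⟩, fwdDiff_zpow_succ n⟩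
      | zero => exact ⟨0, Submodule.zero_mem _, fwdDiff_iter_zero' 1⟩
      | add g₁ g₂ _ _ h₁ h₂ =>
        obtain ⟨G₁, m₁, rfl⟩ := h₁
        obtain ⟨G₂, m₂, rfl⟩ := h₂
        exact ⟨G₁ + G₂, Submodule.add_mem _ m₁ m₂, fwdDiff_add 1 G₁ G₂⟩
      | smul c g _ h =>
        obtain ⟨G, m, rfl⟩ := h
        exact ⟨c • G, Submodule.smul_mem _ c m, fwdDiff_const_smul 1 c G⟩
    obtain ⟨G, hG, hGf⟩ := lift _ hg
    have hGda := (hle hG).1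
    have hc : ∀ z, f z - G z = f 0 - G 0 := by
      refine const_of_step_re (h := fun z => f z - G z) ?_ ?_
      · rw [isDA_iff] at hf hGda ⊢
        intro x y
        linear_combination hf x y - hGda x y
      · intro x y
        have := congrFun hGf ⟨x, y⟩
        simp only [fwdDiff, mk_add_one] at this
        linear_combination -this
    have : f = G + (f 0 - G 0) • zpow 0 := by
      funext z
      have := hc z
      simp [zpow]
      linear_combination this
    rw [this]
    exact Submodule.add_mem _ hG (Submodule.smul_mem _ _ (Submodule.subset_span ⟨0, rfl⟩))

/-- The basis `z^{(0)}, z^{(1)}, …` of the space of discrete analytic polynomials. -/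
def zBasis : Module.Basis ℕ ℂ DAPoly :=
  Module.Basis.mk (v := zpowDA)
    (LinearIndependent.of_comp DAPoly.subtype linearIndependent_zpow)
    (by
      rintro ⟨f, hf⟩ -
      have h := mem_span_zpow hf.1 hf.2
      have e : Set.range zpow = DAPoly.subtype '' Set.range zpowDA := by
        rw [← Set.range_comp]
        rfl
      rw [e, Submodule.span_image] at h
      obtain ⟨g, hg, hgf⟩ := h
      have : g = ⟨f, hf⟩ := Subtype.ext hgf
      exact this ▸ hg)

/-! ### The convolution product -/

/-- The convolution product
`(∑ aₘ z^{(m)}) ⊙ (∑ bₙ z^{(n)}) = ∑ ∑ aₘ bₙ z^{(m+n)}` of discrete analytic polynomials. -/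
def conv (f g : DAPoly) : DAPoly :=
  (zBasis.repr f).sum fun m a => (zBasis.repr g).sum fun n b => (a * b) • zpowDA (m + n)

instance instMulDAPoly : Mul DAPoly := ⟨conv⟩

instance instOneDAPoly : One DAPoly := ⟨zpowDA 0⟩

/-- The linear isomorphism `z^{(n)} ↦ Xⁿ`. -/
def toPolynomial : DAPoly ≃ₗ[ℂ] Polynomial ℂ :=
  zBasis.equiv (Polynomial.basisMonomials ℂ) (Equiv.refl ℕ)

theorem toPolynomial_zpowDA (n : ℕ) : toPolynomial (zpowDA n) = Polynomial.X ^ n := by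
  have : zpowDA n = zBasis n := by simp [zBasis]
  rw [this, toPolynomial, Module.Basis.equiv_apply]
  simp [Polynomial.X_pow_eq_monomial]

theorem toPolynomial_mul (f g : DAPoly) :
    toPolynomial (f * g) = toPolynomial f * toPolynomial g := by
  have h : ∀ f : DAPoly, toPolynomial f =
      (zBasis.repr f).sum fun m a => a • (Polynomial.X ^ m : Polynomial ℂ) := by
    intro f
    conv_lhs => rw [← zBasis.linearCombination_repr f]
    rw [Finsupp.linearCombination_apply, map_finsuppSum]
    refine Finsupp.sum_congr fun m _ => ?_
    rw [map_smul, ← toPolynomial_zpowDA]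
    simp [zBasis]
  change toPolynomial (conv f g) = _
  rw [conv, h f, h g, map_finsuppSum, Finsupp.sum_mul]
  refine Finsupp.sum_congr fun m _ => ?_
  rw [map_finsuppSum, Finsupp.mul_sum]
  refine Finsupp.sum_congr fun n _ => ?_
  rw [map_smul, toPolynomial_zpowDA, smul_mul_smul_comm, pow_add]

theorem toPolynomial_one : toPolynomial 1 = 1 := toPolynomial_zpowDA 0

/-- The ring of discrete analytic polynomials: pointwise addition, the product `⊙`. -/
instance instCommRingDAPoly : CommRing DAPoly :=
  { (inferInstance : AddCommGroup DAPoly), instMulDAPoly, instOneDAPoly with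
    mul_assoc := fun a b c => toPolynomial.injective (by simp only [toPolynomial_mul, mul_assoc])
    mul_comm := fun a b => toPolynomial.injective (by simp only [toPolynomial_mul, mul_comm])
    one_mul := fun a => toPolynomial.injective (by
      simp only [toPolynomial_mul, toPolynomial_one, one_mul])
    mul_one := fun a => toPolynomial.injective (by
      simp only [toPolynomial_mul, toPolynomial_one, mul_one])
    zero_mul := fun a => toPolynomial.injective (by
      simp only [toPolynomial_mul, map_zero, zero_mul])
    mul_zero := fun a => toPolynomial.injective (by
      simp only [toPolynomial_mul, map_zero, mul_zero])
    left_distrib := fun a b c => toPolynomial.injective (by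
      simp only [toPolynomial_mul, map_add, mul_add])
    right_distrib := fun a b c => toPolynomial.injective (by
      simp only [toPolynomial_mul, map_add, add_mul]) }

/-- The discrete analytic polynomial `z + c`. -/
def linearDA (c : ℂ) : DAPoly :=
  ⟨fun z => (z : ℂ) + c, by
    rw [isDA_iff]
    intro x y
    simp only [GaussianInt.toComplex_def']
    push_cast
    linear_combination I_mul_I, isPoly_self.add (IsPoly.const c)⟩

/-! ### The interpolation problem -/

/-- The half-lattice `Λ₊`. -/
def halfLattice : Set GaussianInt := {z | 0 ≤ z.re}

/-- The rectangle `R_λ`. -/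
def rectangle (l : GaussianInt) : Set GaussianInt :=
  {z | z ∈ halfLattice ∧ z.re ≤ l.re ∧ |z.im| ≤ |l.im| ∧ 0 ≤ z.im * l.im}

/-- Membership in the Hardy space `H₂(Λ₊)`: on `Λ₊` the function is the sum of a series
`∑ a(n) z^{(n)}` with square summable coefficients (such a sum is automatically discrete analytic on `Λ₊`).
Only the values on `Λ₊` matter. -/
def MemHardy (f : GaussianInt → ℂ) : Prop :=
  ∃ a : ℕ → ℂ, Summable (fun n => ‖a n‖ ^ 2) ∧
    ∀ z ∈ halfLattice, HasSum (fun n => a n * zpow n z) (f z)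

/-- Solutions of the homogeneous interpolation problem: the functions in `H₂(Λ₊)` that vanish
on the rectangle `R_λ`. -/
def IsSolution (l : GaussianInt) (f : GaussianInt → ℂ) : Prop :=
  MemHardy f ∧ ∀ z ∈ rectangle l, f z = 0

/-- The constant `α_∓`: it is `α₋` if `Im λ ≥ 0` and `α₊` otherwise. -/
def alphaMP (l : GaussianInt) : ℂ := if 0 ≤ l.im then alphaMinus else alphaPlus

/-- The polynomial `z^{(Re λ + 1)} ⊙ (z + α_∓)^{⊙ |Im λ|}`, for `Re λ ≥ 0`. -/
def generator (l : GaussianInt) : DAPoly :=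
  zpowDA (l.re.toNat + 1) * linearDA (alphaMP l) ^ l.im.natAbs

end DiscreteAnalytic

end

namespace DiscreteAnalytic

/-! ### The ring of discrete analytic polynomials as a module over its monomials -/

/-! Under `toPolynomial` the ring is $\mathbb C[X]$, and $\odot$-multiplication by $z^{(1)}=z$ is
the operator $Z$. The horizontal increment of $Zf$ at $z$ is $f(z)$, and
$(Zf)(z+i)+\alpha_-f(z+i)=(Zf)(z)+\alpha_+f(z)$. Since $\alpha_+-\alpha_-=i$, the function
$(z+\alpha_-)\odot f$ has upward increment $i f(z)$ at $z$, and $(z+\alpha_+)\odot f$ has downward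
increment $-i f(z)$. So each factor $z$ adds a column of zeros along the real axis, and each factor
$z+\alpha_\mp$ adds a row in the direction of $\Im\lambda$.

For the converse, write $p=(z+c)\odot q+k$ with $k$ constant. The constant drops out of increments,
so zeros of $p$ on a rectangle give zeros of $q$ on the rectangle with one row (or, for $c=0$ on the
axis, one column) fewer. Evaluation at $0$ then forces $k=0$, because $(Zq)(0)=0$ and $c\,q(0)=0$.
Induction on the number of columns (`vanishesOn_row_iff`) and then of rows (`vanishesOn_iff`) gives
the factorization. The ideal statement follows because every discrete analytic polynomial lies in
$\mathbf H_2(\Lambda_+)$ (`memHardy_DAPoly`). -/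

theorem zpowDA_induction {motive : DAPoly → Prop} (hz : ∀ n, motive (zpowDA n))
    (hadd : ∀ f g, motive f → motive g → motive (f + g))
    (hsmul : ∀ (c : ℂ) f, motive f → motive (c • f)) (f : DAPoly) : motive f := by
  have hf : f ∈ Submodule.span ℂ (Set.range zBasis) := zBasis.mem_span f
  induction hf using Submodule.span_induction with
  | mem g hg =>
    obtain ⟨n, rfl⟩ := hg
    simpa [zBasis] using hz n
  | zero => simpa using hsmul 0 _ (hz 0)
  | add f g _ _ h₁ h₂ => exact hadd f g h₁ h₂
  | smul c f _ h => exact hsmul c f h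

theorem smul_mul_DAPoly (c : ℂ) (f g : DAPoly) : (c • f) * g = c • (f * g) :=
  toPolynomial.injective (by simp only [toPolynomial_mul, map_smul, smul_mul_assoc])

theorem mul_smul_DAPoly (c : ℂ) (f g : DAPoly) : f * (c • g) = c • (f * g) := by
  rw [mul_comm, smul_mul_DAPoly, mul_comm]

theorem zpowDA_mul (m n : ℕ) : zpowDA m * zpowDA n = zpowDA (m + n) :=
  toPolynomial.injective (by simp only [toPolynomial_mul, toPolynomial_zpowDA, pow_add])

theorem zpowDA_zero : zpowDA 0 = 1 := rfl

theorem add_coe (f g : DAPoly) (z : GaussianInt) :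
    ((f + g : DAPoly) : GaussianInt → ℂ) z = (f : GaussianInt → ℂ) z + (g : GaussianInt → ℂ) z :=
  rfl

theorem smul_coe (c : ℂ) (f : DAPoly) (z : GaussianInt) :
    ((c • f : DAPoly) : GaussianInt → ℂ) z = c * (f : GaussianInt → ℂ) z := rfl

theorem one_coe (z : GaussianInt) : ((1 : DAPoly) : GaussianInt → ℂ) z = 1 := rfl

/-- The difference of the two sides is discrete analytic with zero horizontal increments, hence
constant, and it is $0$ at the origin. This identifies `linearDA c` with the monic linear polynomial
$X+c$. -/
theorem zpow_one (z : GaussianInt) : zpow 1 z = z := by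
  obtain ⟨x, y⟩ := z
  have h0 : ∀ z, zpow 0 z = 1 := fun _ => rfl
  have hstep : ∀ x y : ℤ, zpow 1 ⟨x + 1, y⟩ = zpow 1 ⟨x, y⟩ + 1 := by
    intro x y
    have := Zop_step_re (isDA_zpow 0) x y
    rw [← zpow_succ, h0] at this
    linear_combination this
  have h := const_of_step_re (h := fun z => zpow 1 z - z) ?_ ?_ ⟨x, y⟩
  · rw [zpow_apply_zero] at h
    simp only [one_ne_zero, if_false, GaussianInt.toComplex_zero, sub_zero] at h
    linear_combination h
  · have h1 := (isDA_iff _).1 (isDA_zpow 1)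
    rw [isDA_iff]
    intro x y
    simp only [GaussianInt.toComplex_def']
    push_cast
    linear_combination h1 x y - I_mul_I
  · intro x y
    simp only [hstep, GaussianInt.toComplex_def']
    push_cast
    ring

theorem linearDA_eq (c : ℂ) : linearDA c = zpowDA 1 + c • (1 : DAPoly) := by
  refine Subtype.ext (funext fun z => ?_)
  rw [add_coe, smul_coe, one_coe]
  change (z : ℂ) + c = zpow 1 z + c * 1
  rw [zpow_one, mul_one]

theorem linearDA_mul (c : ℂ) (f : DAPoly) : linearDA c * f = zpowDA 1 * f + c • f := by
  rw [linearDA_eq, add_mul, smul_mul_DAPoly, one_mul]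

theorem linearDA_zero : linearDA 0 = zpowDA 1 := by
  rw [linearDA_eq, zero_smul, add_zero]

/-- Division with remainder by `z + c`. -/
theorem exists_eq_linearDA_mul_add (c : ℂ) (f : DAPoly) :
    ∃ (q : DAPoly) (k : ℂ), f = linearDA c * q + k • (1 : DAPoly) := by
  induction f using zpowDA_induction with
  | hz n =>
    induction n with
    | zero => exact ⟨0, 1, by rw [mul_zero, zero_add, one_smul, zpowDA_zero]⟩
    | succ n ih =>
      obtain ⟨q, k, h⟩ := ih
      -- From $z^{(n+1)}=(z+c)\odot z^{(n)}-c\,z^{(n)}$, with the inductive division substituted in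
      -- the last term.
      refine ⟨zpowDA n - c • q, -c * k, ?_⟩
      have h1 := linearDA_mul c (zpowDA n)
      rw [zpowDA_mul, add_comm 1 n] at h1
      rw [mul_sub, h1, mul_smul_DAPoly, h, smul_add, smul_smul, neg_mul, neg_smul]
      abel
  | hadd f g hf hg =>
    obtain ⟨q, k, rfl⟩ := hf
    obtain ⟨r, l, rfl⟩ := hg
    exact ⟨q + r, k + l, by rw [mul_add, add_smul]; abel⟩
  | hsmul a f hf =>
    obtain ⟨q, k, rfl⟩ := hf
    exact ⟨a • q, a * k, by rw [smul_add, smul_smul, mul_smul_DAPoly]⟩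

/-! ### Multiplication by linear factors -/

theorem zpowDA_one_mul_coe_zero (f : DAPoly) :
    ((zpowDA 1 * f : DAPoly) : GaussianInt → ℂ) 0 = 0 := by
  induction f using zpowDA_induction with
  | hz n =>
    rw [zpowDA_mul, add_comm]
    exact (zpow_apply_zero (n + 1)).trans (if_neg n.succ_ne_zero)
  | hadd f g hf hg => rw [mul_add, add_coe, hf, hg, add_zero]
  | hsmul c f hf => rw [mul_smul_DAPoly, smul_coe, hf, mul_zero]

theorem zpowDA_one_mul_step_re (f : DAPoly) (x y : ℤ) :
    ((zpowDA 1 * f : DAPoly) : GaussianInt → ℂ) ⟨x + 1, y⟩ =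
      ((zpowDA 1 * f : DAPoly) : GaussianInt → ℂ) ⟨x, y⟩ + (f : GaussianInt → ℂ) ⟨x, y⟩ := by
  induction f using zpowDA_induction with
  | hz n =>
    rw [zpowDA_mul, add_comm 1 n]
    have := Zop_step_re (isDA_zpow n) x y
    rw [← zpow_succ] at this
    simp only [zpowDA]
    linear_combination this
  | hadd f g hf hg =>
    simp only [mul_add, add_coe]
    linear_combination hf + hg
  | hsmul c f hf =>
    simp only [mul_smul_DAPoly, smul_coe]
    linear_combination c * hf

/-- On monomials this is the coefficient of $t^{n+1}$ in the vertical recursion `genSeries_step_im`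
of the generating function; the general case is linear. -/
theorem zpowDA_one_mul_step_im (f : DAPoly) (x y : ℤ) :
    ((zpowDA 1 * f : DAPoly) : GaussianInt → ℂ) ⟨x, y + 1⟩ +
        alphaMinus * (f : GaussianInt → ℂ) ⟨x, y + 1⟩ =
      ((zpowDA 1 * f : DAPoly) : GaussianInt → ℂ) ⟨x, y⟩ +
        alphaPlus * (f : GaussianInt → ℂ) ⟨x, y⟩ := by
  induction f using zpowDA_induction with
  | hz n =>
    have h := congrArg (PowerSeries.coeff (n + 1)) (genSeries_step_im x y)
    simp only [add_mul, one_mul, map_add, mul_assoc, PowerSeries.coeff_C_mul,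
      PowerSeries.coeff_succ_X_mul, coeff_genSeries] at h
    rw [zpowDA_mul, add_comm 1 n]
    exact h
  | hadd f g hf hg =>
    simp only [mul_add, add_coe]
    linear_combination hf + hg
  | hsmul c f hf =>
    simp only [mul_smul_DAPoly, smul_coe]
    linear_combination c * hf

theorem alphaPlus_sub_alphaMinus : alphaPlus - alphaMinus = I := by
  simp only [alphaPlus, alphaMinus]
  ring

/-- Adding $\alpha_-f$ to $Zf$ absorbs the value of $f$ at the upper point, so only the lower value
remains, with coefficient $\alpha_+-\alpha_-=i$. -/
theorem linearDA_alphaMinus_mul_step (f : DAPoly) (x y : ℤ) :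
    ((linearDA alphaMinus * f : DAPoly) : GaussianInt → ℂ) ⟨x, y + 1⟩ =
      ((linearDA alphaMinus * f : DAPoly) : GaussianInt → ℂ) ⟨x, y⟩ +
        I * (f : GaussianInt → ℂ) ⟨x, y⟩ := by
  simp only [linearDA_mul, add_coe, smul_coe]
  linear_combination zpowDA_one_mul_step_im f x y +
    (f : GaussianInt → ℂ) ⟨x, y⟩ * alphaPlus_sub_alphaMinus

/-- The mirror case: adding $\alpha_+f$ absorbs the value at the lower point, so zeros propagate
downwards. -/
theorem linearDA_alphaPlus_mul_step (f : DAPoly) (x y : ℤ) :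
    ((linearDA alphaPlus * f : DAPoly) : GaussianInt → ℂ) ⟨x, y - 1⟩ =
      ((linearDA alphaPlus * f : DAPoly) : GaussianInt → ℂ) ⟨x, y⟩ -
        I * (f : GaussianInt → ℂ) ⟨x, y⟩ := by
  have h := zpowDA_one_mul_step_im f x (y - 1)
  rw [sub_add_cancel] at h
  simp only [linearDA_mul, add_coe, smul_coe]
  linear_combination -h - (f : GaussianInt → ℂ) ⟨x, y⟩ * alphaPlus_sub_alphaMinus

/-! ### Polynomials that vanish on a rectangle -/

/-- `f` vanishes at the points `j + e k i` with `0 ≤ j < a`, `0 ≤ k ≤ b`. -/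
def VanishesOn (e : ℤ) (a b : ℕ) (f : DAPoly) : Prop :=
  ∀ j k : ℕ, j < a → k ≤ b → (f : GaussianInt → ℂ) ⟨j, e * k⟩ = 0

theorem zpowDA_one_mul_vanishes_row {a : ℕ} {f : DAPoly}
    (h : ∀ j : ℕ, j < a → (f : GaussianInt → ℂ) ⟨j, 0⟩ = 0) (j : ℕ) (hj : j ≤ a) :
    ((zpowDA 1 * f : DAPoly) : GaussianInt → ℂ) ⟨j, 0⟩ = 0 := by
  induction j with
  | zero => exact zpowDA_one_mul_coe_zero f
  | succ j ih =>
    rw [Nat.cast_succ, zpowDA_one_mul_step_re, ih (by omega), h j hj, zero_add]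

/-- At $0$ the division identity reads $f(0)=c\,q(0)+k$, so the remainder vanishes. The hypothesis
concerns the product $c\,q(0)$ so that it is automatic for $c=0$, where nothing is known about
$q(0)$. -/
theorem exists_eq_linearDA_mul {c : ℂ} {f : DAPoly} (hf : (f : GaussianInt → ℂ) 0 = 0)
    (hq : ∀ (q : DAPoly) (k : ℂ), f = linearDA c * q + k • (1 : DAPoly) →
      c * (q : GaussianInt → ℂ) 0 = 0) : ∃ q : DAPoly, f = linearDA c * q := by
  obtain ⟨q, k, h⟩ := exists_eq_linearDA_mul_add c f
  refine ⟨q, ?_⟩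
  have h0 := hf
  rw [h, add_coe, smul_coe, one_coe, linearDA_mul, add_coe, smul_coe, zpowDA_one_mul_coe_zero,
    hq q k h, zero_add, zero_add, mul_one] at h0
  rw [h, h0, zero_smul, add_zero]

theorem vanishesOn_row_iff (e : ℤ) (a : ℕ) (f : DAPoly) :
    VanishesOn e a 0 f ↔ ∃ q, f = zpowDA a * q := by
  have row : ∀ (a : ℕ) (f : DAPoly), VanishesOn e a 0 f ↔
      ∀ j : ℕ, j < a → (f : GaussianInt → ℂ) ⟨j, 0⟩ = 0 := by
    intro a f
    constructor
    · intro h j hj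
      simpa using h j 0 hj le_rfl
    · intro h j k hj hk
      obtain rfl : k = 0 := by omega
      simpa using h j hj
  induction a generalizing f with
  | zero =>
    exact ⟨fun _ => ⟨f, by rw [zpowDA_zero, one_mul]⟩, fun _ j k hj => absurd hj (by omega)⟩
  | succ a ih =>
    constructor
    · intro h
      rw [row] at h
      -- Division by $z=z+0$; the horizontal increments of $z\odot q$ then show that $q$ vanishes at
      -- one point fewer.
      obtain ⟨q, rfl⟩ := exists_eq_linearDA_mul (c := 0) (h 0 (by omega))
        (fun _ _ _ => zero_mul _)
      rw [linearDA_zero] at h ⊢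
      obtain ⟨r, rfl⟩ := (ih q).1 ((row a q).2 fun j hj => by
        have h1 := zpowDA_one_mul_step_re q j 0
        have h2 := h (j + 1) (by omega)
        rw [Nat.cast_succ] at h2
        rw [h2, h j (by omega), zero_add] at h1
        exact h1.symm)
      exact ⟨r, by rw [← mul_assoc, zpowDA_mul, add_comm]⟩
    · rintro ⟨q, rfl⟩
      rw [row, add_comm, ← zpowDA_mul, mul_assoc]
      intro j hj
      exact zpowDA_one_mul_vanishes_row ((row a _).1 ((ih _).2 ⟨q, rfl⟩)) j (by omega)

/-- Treats both signs of $\Im\lambda$ at once: $(e,c,w)$ will be $(1,\alpha_-,i)$ or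
$(-1,\alpha_+,-i)$. At least one column is needed so that the origin belongs to the block and the
remainder can be shown to vanish. -/
theorem vanishesOn_iff {e : ℤ} {c w : ℂ} (hw : w ≠ 0)
    (hstep : ∀ (f : DAPoly) (x y : ℤ),
      ((linearDA c * f : DAPoly) : GaussianInt → ℂ) ⟨x, y + e⟩ =
        ((linearDA c * f : DAPoly) : GaussianInt → ℂ) ⟨x, y⟩ + w * (f : GaussianInt → ℂ) ⟨x, y⟩)
    {a : ℕ} (ha : 0 < a) (b : ℕ) (f : DAPoly) :
    VanishesOn e a b f ↔ ∃ q, f = zpowDA a * linearDA c ^ b * q := by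
  induction b generalizing f with
  | zero => simpa only [pow_zero, mul_one] using vanishesOn_row_iff e a f
  | succ b ih =>
    have hcast : ∀ k : ℕ, e * ((k + 1 : ℕ) : ℤ) = e * k + e := by
      intro k
      push_cast
      ring
    constructor
    · intro h
      -- Stated with an arbitrary remainder $k$, which cancels in vertical differences: it serves
      -- first to get $q(0)=0$, whence $k=0$, and then to apply the induction hypothesis to the
      -- exact quotient.
      have key : ∀ (q : DAPoly) (k : ℂ), f = linearDA c * q + k • (1 : DAPoly) →
          VanishesOn e a b q := by
        intro q k hq i j hi hj
        have h1 := h i j hi (by omega)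
        have h2 := h i (j + 1) hi (by omega)
        rw [hq, add_coe, smul_coe, one_coe] at h1 h2
        rw [hcast, hstep] at h2
        have h3 : w * (q : GaussianInt → ℂ) ⟨i, e * j⟩ = 0 := by linear_combination h2 - h1
        exact (mul_eq_zero.1 h3).resolve_left hw
      have origin : ∀ {n : ℕ} {g : DAPoly}, VanishesOn e a n g → (g : GaussianInt → ℂ) 0 = 0 := by
        intro n g hg
        have h0 := hg 0 0 ha (Nat.zero_le n)
        rw [Nat.cast_zero, mul_zero] at h0
        exact h0
      obtain ⟨q, rfl⟩ := exists_eq_linearDA_mul (c := c) (origin h) (fun q k hq => by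
        rw [origin (key q k hq), mul_zero])
      obtain ⟨r, rfl⟩ := (ih q).1 (key q 0 (by rw [zero_smul, add_zero]))
      exact ⟨r, by ring⟩
    · rintro ⟨q, rfl⟩
      have hv := (ih (zpowDA a * linearDA c ^ b * q)).2 ⟨q, rfl⟩
      rw [show zpowDA a * linearDA c ^ (b + 1) * q =
        linearDA c * (zpowDA a * linearDA c ^ b * q) by ring]
      generalize zpowDA a * linearDA c ^ b * q = g at hv
      intro j k hj hk
      induction k with
      | zero =>
        -- On the real axis $(z+c)\odot g=Zg+c\,g$, and both terms vanish where $g$ does; the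
        -- vertical step rule then carries the zeros one row beyond those of $g$.
        have hrow : ∀ i : ℕ, i < a → (g : GaussianInt → ℂ) ⟨i, 0⟩ = 0 := by
          intro i hi
          simpa using hv i 0 hi (Nat.zero_le b)
        rw [Nat.cast_zero, mul_zero, linearDA_mul, add_coe, smul_coe,
          zpowDA_one_mul_vanishes_row hrow j hj.le, hrow j hj, mul_zero, add_zero]
      | succ k ihk =>
        rw [hcast, hstep, ihk (by omega), hv j k hj (by omega), mul_zero, add_zero]

/-- Here $e=\pm1$ is the sign of $\Im\lambda$. For $\Im\lambda=0$ the sign condition in $R_\lambda$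
is void, but the bound on $|\Im z|$ leaves only the real axis, so either sign would do. -/
theorem vanishes_rectangle_iff {l : GaussianInt} (hl : l ∈ halfLattice) {e : ℤ}
    (he : e * e = 1) (hel : l.im = e * l.im.natAbs) (hz : l.im = 0 ∨ 0 < e * l.im) (f : DAPoly) :
    (∀ z ∈ rectangle l, (f : GaussianInt → ℂ) z = 0) ↔
      VanishesOn e (l.re.toNat + 1) l.im.natAbs f := by
  have hl' : 0 ≤ l.re := hl
  constructor
  · intro h j k hj hk
    refine h _ ⟨Int.natCast_nonneg j, ?_, ?_, ?_⟩
    · change (j : ℤ) ≤ l.re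
      omega
    · change |e * (k : ℤ)| ≤ |l.im|
      have he' : |e| = 1 := by
        rcases Int.isUnit_iff.1 (IsUnit.of_mul_eq_one e he) with rfl | rfl <;> rfl
      rw [abs_mul, he', one_mul, Nat.abs_cast, Int.abs_eq_natAbs]
      exact_mod_cast hk
    · change 0 ≤ e * (k : ℤ) * l.im
      rw [hel, mul_mul_mul_comm, he, one_mul]
      positivity
  · rintro h ⟨x, y⟩ ⟨hx0, hx, hy, hyl⟩
    simp only at hx hy hyl
    change 0 ≤ x at hx0
    have hy' : y.natAbs ≤ l.im.natAbs := by
      rw [Int.abs_eq_natAbs, Int.abs_eq_natAbs] at hy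
      exact_mod_cast hy
    have hey : 0 ≤ e * y := by
      rcases hz with hz | hz
      · obtain rfl : y = 0 := by rw [hz] at hy'; simpa using hy'
        simp
      -- Since $e^2=1$, the product of $e\,\Im z$ and $e\,\Im\lambda>0$ is $\Im z\,\Im\lambda\ge0$.
      · refine nonneg_of_mul_nonneg_left (b := e * l.im) ?_ hz
        rw [mul_mul_mul_comm, he, one_mul]
        exact hyl
    have hyk : y = e * (y.natAbs : ℤ) := by
      rcases Int.isUnit_iff.1 (IsUnit.of_mul_eq_one e he) with rfl | rfl <;> omega
    have := h x.toNat y.natAbs (by omega) hy'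
    rwa [← hyk, Int.toNat_of_nonneg hx0] at this

theorem vanishes_rectangle_iff_generator {l : GaussianInt} (hl : l ∈ halfLattice) (f : DAPoly) :
    (∀ z ∈ rectangle l, (f : GaussianInt → ℂ) z = 0) ↔ ∃ q, f = generator l * q := by
  unfold generator alphaMP
  by_cases h : 0 ≤ l.im
  · rw [if_pos h, vanishes_rectangle_iff hl (e := 1) (by norm_num) (by omega) (by omega)]
    exact vanishesOn_iff I_ne_zero linearDA_alphaMinus_mul_step (Nat.succ_pos _) _ f
  · rw [if_neg h, vanishes_rectangle_iff hl (e := -1) (by norm_num) (by omega) (by omega)]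
    refine vanishesOn_iff (neg_ne_zero.2 I_ne_zero) (fun f x y => ?_) (Nat.succ_pos _) _ f
    rw [neg_mul, ← sub_eq_add_neg, ← sub_eq_add_neg]
    exact linearDA_alphaPlus_mul_step f x y

/-! ### Membership in the Hardy space and the principal ideal -/

/-- The coefficients in the basis $z^{(n)}$ are finitely supported, so both series are finite sums.
-/
theorem memHardy_DAPoly (f : DAPoly) : MemHardy (f : GaussianInt → ℂ) := by
  refine ⟨fun n => zBasis.repr f n, summable_of_hasFiniteSupport ?_, fun z _ => ?_⟩
  · refine (zBasis.repr f).hasFiniteSupport.subset fun n hn => ?_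
    contrapose! hn
    simp only [Function.mem_support, not_not] at hn
    simp [hn]
  · have h : (f : GaussianInt → ℂ) z =
        ∑ n ∈ (zBasis.repr f).support, zBasis.repr f n * zpow n z := by
      conv_lhs => rw [← zBasis.linearCombination_repr f]
      rw [Finsupp.linearCombination_apply, Finsupp.sum, AddSubmonoidClass.coe_finsetSum,
        Finset.sum_apply]
      refine Finset.sum_congr rfl fun n _ => ?_
      simp [zBasis, zpowDA]
    rw [h]
    refine hasSum_sum_of_ne_finset_zero fun n hn => ?_
    simp only [Finsupp.notMem_support_iff.1 hn, zero_mul]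

end DiscreteAnalytic

theorem mainTheorem7 (l : GaussianInt) (hl : l ∈ DiscreteAnalytic.halfLattice) :
    (∀ p : DiscreteAnalytic.DAPoly,
      (∀ z ∈ DiscreteAnalytic.rectangle l, (p : GaussianInt → ℂ) z = 0) ↔
        ∃ q : DiscreteAnalytic.DAPoly, p = DiscreteAnalytic.generator l * q) ∧
    ∃ I : Ideal DiscreteAnalytic.DAPoly,
      (I : Set DiscreteAnalytic.DAPoly) =
        {p : DiscreteAnalytic.DAPoly | DiscreteAnalytic.IsSolution l (p : GaussianInt → ℂ)} ∧
      I = Ideal.span {DiscreteAnalytic.generator l} := by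
  -- The final `rfl` fixes the ideal as the span of the generator; what remains is that its elements
  -- are exactly the solutions, where the Hardy condition holds automatically.
  refine ⟨DiscreteAnalytic.vanishes_rectangle_iff_generator hl, _, ?_, rfl⟩
  ext p
  rw [SetLike.mem_coe, Ideal.mem_span_singleton]
  exact (DiscreteAnalytic.vanishes_rectangle_iff_generator hl p).symm.trans
    (and_iff_right (DiscreteAnalytic.memHardy_DAPoly p)).symm
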